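/- Let $k\ge 2$ be an integer and let $\mathbf{x}=a_0a_1a_2\cdots$ be a $k$-automatic sequence over a linearly ordered alphabet; that is, there is a deterministic finite automaton with an output associated with each state such that, for every $n\ge 0$, the automaton reading the base-$k$ representation of $n$ ends in a state with output $a_n$. A nonempty finite word is a power if it equals $u^m$ for some word $u$ and some integer $m\ge 2$, and is primitive otherwise; a word is Lyndon if it is primitive and lexicographically least among all its conjugates (the words $vu$ with $w=uv$). Then the function that maps $n\ge 0$ to the number of distinct primitive factors of $\mathbf{x}$ of length $n$ is $k$-regular, and so is the function that maps $n\ge 0$ to the number of distinct Lyndon factors of $\mathbf{x}$ of length $n$. Here a sequence $(b_n)_{n\ge 0}$ of natural numbers is called $k$-regular if there are an integer $d\ge 0$, a row vector $u$ and a column vector $v$ of dimension $d$, and $d\times d$ matrices $\mu(0),\dots,\mu(k-1)$, all with entries in $\mathbb{N}=\{0,1,2,\dots\}$, such that $b_n=u\,\mu(c_1)\cdots\mu(c_r)\,v$ for every $n\ge 0$, where $c_1\cdots c_r$ is the base-$k$ representation of $n$ (most significant digit first, with no leading zeros, and empty for $n=0$). -/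

import Mathlib

namespace AutoSeq

/-! ### Finite words -/

/-- A nonempty word is a power if it is `u ^ m` for some word `u` and some `m ≥ 2`. -/
def IsPower {A : Type*} (w : List A) : Prop :=
  w ≠ [] ∧ ∃ (u : List A) (m : ℕ), 2 ≤ m ∧ w = (List.replicate m u).flatten

/-- A nonempty word is primitive if it is not a power. -/
def IsPrimitive {A : Type*} (w : List A) : Prop :=
  w ≠ [] ∧ ¬ IsPower w

/-- `w` and `x` are conjugates if `w = u v` and `x = v u` for some words `u`, `v`. -/
def IsConjugate {A : Type*} (w x : List A) : Prop :=
  ∃ u v : List A, w = u ++ v ∧ x = v ++ u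

/-- A word is Lyndon if it is primitive and lexicographically least among its conjugates.
The order on `List A` is the lexicographic one, a proper prefix of a word being smaller than it. -/
def IsLyndon {A : Type*} [LinearOrder A] (w : List A) : Prop :=
  IsPrimitive w ∧ ∀ x : List A, IsConjugate w x → w ≤ x

/-! ### Factors of an infinite word -/

/-- The factor of length `n` of the infinite word `x` that starts at position `i`. -/
def factorAt {A : Type*} (x : ℕ → A) (i n : ℕ) : List A :=
  (List.range n).map fun j => x (i + j)

/-- The set of factors of length `n` of the infinite word `x`. -/
def factors {A : Type*} (x : ℕ → A) (n : ℕ) : Set (List A) :=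
  Set.range fun i => factorAt x i n

/-- The number of distinct primitive factors of length `n`. -/
noncomputable def primitiveComplexity {A : Type*} (x : ℕ → A) (n : ℕ) : ℕ :=
  {w | w ∈ factors x n ∧ IsPrimitive w}.ncard

/-- The number of distinct Lyndon factors of length `n`. -/
noncomputable def lyndonComplexity {A : Type*} [LinearOrder A] (x : ℕ → A) (n : ℕ) : ℕ :=
  {w | w ∈ factors x n ∧ IsLyndon w}.ncard

/-! ### Automatic and regular sequences -/

/-- The base-`k` representation of `n`, most significant digit first and without leading zeros
(the representation of `0` is the empty word). -/
def baseRep (k : ℕ) (hk : 2 ≤ k) (n : ℕ) : List (Fin k) :=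
  ((Nat.digits k n).pmap Fin.mk fun _ hd => Nat.digits_lt_base hk hd).reverse

/-- A deterministic automaton over the input alphabet `Fin k`, with state set `σ`
and an output in `A` associated with each state. -/
structure DFAO (k : ℕ) (σ : Type*) (A : Type*) where
  /-- The transition function. -/
  step : σ → Fin k → σ
  /-- The initial state. -/
  start : σ
  /-- The output associated with each state. -/
  output : σ → A

/-- The output of the state reached from the initial state after reading `w` from left to right. -/
def DFAO.run {k : ℕ} {σ A : Type*} (M : DFAO k σ A) (w : List (Fin k)) : A :=
  M.output (w.foldl M.step M.start)

/-- `x` is `k`-automatic if some finite automaton with output, on the base-`k` representation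
of `n`, outputs `x n`, for every `n`. -/
def IsAutomatic {A : Type*} (k : ℕ) (hk : 2 ≤ k) (x : ℕ → A) : Prop :=
  ∃ (σ : Type) (_ : Finite σ) (M : DFAO k σ A), ∀ n : ℕ, M.run (baseRep k hk n) = x n

/-- A sequence `a` over `ℕ` is `k`-regular if there are a dimension `d`, a row vector `u` and
a column vector `v` and square matrices `μ c`, one for each digit `c`, all with entries in `ℕ`,
such that `a n = u * μ c₁ * ⋯ * μ cᵣ * v` whenever `c₁ ⋯ cᵣ` is the base-`k` representation
of `n`. -/
def IsRegular (k : ℕ) (hk : 2 ≤ k) (a : ℕ → ℕ) : Prop :=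
  ∃ (d : ℕ) (u v : Fin d → ℕ) (μ : Fin k → Matrix (Fin d) (Fin d) ℕ),
    ∀ n : ℕ, a n = u ⬝ᵥ Matrix.mulVec ((baseRep k hk n).map μ).prod v

/-- An automatic sequence has finitely many factors of each length, so that the cardinalities
in `primitiveComplexity` and `lyndonComplexity` are genuine. -/
theorem IsAutomatic.finite_factors {A : Type*} {k : ℕ} {hk : 2 ≤ k} {x : ℕ → A}
    (hx : IsAutomatic k hk x) (n : ℕ) : (factors x n).Finite := by
  obtain ⟨σ, _, M, hM⟩ := hx
  have hr : (Set.range x).Finite := by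
    refine (Set.finite_range M.output).subset ?_
    rintro _ ⟨m, rfl⟩
    exact ⟨_, hM m⟩
  have := hr.to_subtype
  refine (((List.finite_length_eq (Set.range x) n).image (List.map Subtype.val))).subset ?_
  rintro _ ⟨i, rfl⟩
  refine ⟨(List.range n).map fun j => ⟨x (i + j), i + j, rfl⟩, by simp, ?_⟩
  simp [factorAt]

end AutoSeq

namespace AutoSeq

/-! Count each factor of length n by its first occurrence i. That i is a first occurrence, and that
the factor there is primitive or Lyndon, can be expressed by quantifying over natural numbers, with
comparisons of additive expressions and of letters of x at such positions. Primitivity and the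
Lyndon property are put in this form through rotations, where the index (q + d) mod n is either q +
d or q + d - n. All such relations have a finite `k`-kernel: the atoms because carries stay bounded
(`comp_additive`, `lt`), quantifiers by a subset construction (`exists_update`). Splitting the
counted variable by its last digit then gives a finite system of linear recurrences with
coefficients in ℕ (`isRegular_ncard`), which is a matrix representation (`isRegular_of_family`). -/

/-! ### Recognizable functions on tuples of natural numbers -/

/-- A function on tuples of natural numbers is `k`-recognizable if its `k`-kernel is finite: it
lies in a finite set of functions closed under the substitutions `v ↦ k v + a`, with `a` a tuple
of digits. -/
def Recognizable {ι B : Type*} (k : ℕ) (f : (ι → ℕ) → B) : Prop :=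
  ∃ S : Set ((ι → ℕ) → B), S.Finite ∧ f ∈ S ∧
    ∀ g ∈ S, ∀ a : ι → ℕ, (∀ i, a i < k) → (fun v => g (k • v + a)) ∈ S

namespace Recognizable

variable {ι B C D : Type*} {k : ℕ}

theorem map₂ {f : (ι → ℕ) → B} {g : (ι → ℕ) → C} (hf : Recognizable k f)
    (hg : Recognizable k g) (F : B → C → D) : Recognizable k fun v => F (f v) (g v) := by
  obtain ⟨S, hS, hfS, hS'⟩ := hf
  obtain ⟨T, hT, hgT, hT'⟩ := hg
  refine ⟨Set.image2 (fun f g v => F (f v) (g v)) S T, hS.image2 _ hT, ⟨f, hfS, g, hgT, rfl⟩, ?_⟩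
  rintro _ ⟨f', hf', g', hg', rfl⟩ a ha
  exact ⟨_, hS' f' hf' a ha, _, hT' g' hg' a ha, rfl⟩

theorem and {P Q : (ι → ℕ) → Prop} (hP : Recognizable k P) (hQ : Recognizable k Q) :
    Recognizable k fun v => P v ∧ Q v :=
  hP.map₂ hQ And

theorem imp {P Q : (ι → ℕ) → Prop} (hP : Recognizable k P) (hQ : Recognizable k Q) :
    Recognizable k fun v => P v → Q v :=
  hP.map₂ hQ fun p q => p → q

theorem not {P : (ι → ℕ) → Prop} (hP : Recognizable k P) : Recognizable k fun v => ¬ P v :=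
  hP.map₂ hP fun p _ => ¬ p

/-- Subset construction: shifting by digits splits the quantified number into its last digit d and
its quotient, so the shifted function is again a disjunction over some set of kernel members. A
finite kernel has finitely many subsets. -/
theorem exists_update [DecidableEq ι] (hk : 0 < k) {P : (ι → ℕ) → Prop} (hP : Recognizable k P)
    (i : ι) : Recognizable k fun v => ∃ y, P (Function.update v i y) := by
  obtain ⟨S, hS, hPS, hS'⟩ := hP
  refine ⟨(fun (T : Set ((ι → ℕ) → Prop)) v => ∃ g ∈ T, ∃ y, g (Function.update v i y)) ''
    {T | T ⊆ S}, hS.finite_subsets.image _, ⟨{P}, by simpa using hPS, by simp⟩, ?_⟩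
  rintro _ ⟨T, hT, rfl⟩ a ha
  refine ⟨{h | ∃ g ∈ T, ∃ d < k, h = fun v => g (k • v + Function.update a i d)}, ?_, ?_⟩
  · rintro _ ⟨g, hg, d, hd, rfl⟩
    refine hS' g (hT hg) _ fun j => ?_
    rcases eq_or_ne j i with rfl | hj
    · simpa using hd
    · simpa [hj] using ha j
  · have key : ∀ (v : ι → ℕ) (y d : ℕ), k • Function.update v i y + Function.update a i d =
        Function.update (k • v + a) i (k * y + d) := by
      intro v y d
      ext j
      rcases eq_or_ne j i with rfl | hj
      · simp
      · simp [hj]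
    ext v
    constructor
    · rintro ⟨_, ⟨g, hg, d, hd, rfl⟩, y, hy⟩
      exact ⟨g, hg, k * y + d, by rwa [← key]⟩
    · rintro ⟨g, hg, y, hy⟩
      refine ⟨_, ⟨g, hg, y % k, Nat.mod_lt _ hk, rfl⟩, y / k, ?_⟩
      rwa [key, Nat.div_add_mod]

theorem forall_update [DecidableEq ι] (hk : 0 < k) {P : (ι → ℕ) → Prop} (hP : Recognizable k P)
    (i : ι) : Recognizable k fun v => ∀ y, P (Function.update v i y) := by
  simpa using (hP.not.exists_update hk i).not

end Recognizable

/-! ### Additive maps and comparisons between them -/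

section Linear

variable {ι : Type*} {k : ℕ}

theorem additive_smul_add {l : (ι → ℕ) → ℕ} (hl : ∀ v w, l (v + w) = l v + l w)
    (m : ℕ) (v a : ι → ℕ) : l (m • v + a) = m * l v + l a := by
  have h0 : l 0 = 0 := by simpa using hl 0 0
  rw [hl]
  congr 1
  induction m with
  | zero => simp [h0]
  | succ m ih => rw [succ_nsmul, hl, ih, Nat.succ_mul]

/-- Digits are at most k - 1, so k • 1 is a + 1 plus a nonnegative tuple. This bound keeps carries
in a fixed finite range. -/
theorem additive_le_of_digits {l : (ι → ℕ) → ℕ} (hl : ∀ v w, l (v + w) = l v + l w)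
    {a : ι → ℕ} (ha : ∀ i, a i < k) : l a + l 1 ≤ k * l 1 := by
  have h0 : l 0 = 0 := by simpa using hl 0 0
  have h := additive_smul_add hl k 1 0
  have h' : k • (1 : ι → ℕ) + 0 = a + (1 + fun i => k - 1 - a i) := by
    ext i
    have := ha i
    simp
    omega
  rw [h', hl, hl, h0] at h
  omega

/-- A kernel state is a kernel member of f with a carry c. Since l (k v + a) + c = k l(v) + (l a +
c), the next carry is (l a + c) / k, still at most l 1. -/
theorem Recognizable.comp_additive {B : Type*} {S : Set (ℕ → B)} (hk : 0 < k) (hS : S.Finite)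
    (hS' : ∀ g ∈ S, ∀ a < k, (fun n => g (k * n + a)) ∈ S) {f : ℕ → B} (hf : f ∈ S)
    {l : (ι → ℕ) → ℕ} (hl : ∀ v w, l (v + w) = l v + l w) : Recognizable k fun v => f (l v) := by
  refine ⟨Set.image2 (fun g c v => g (l v + c)) S (Set.Iic (l 1)), hS.image2 _ (Set.finite_Iic _),
    ⟨f, hf, 0, by simp, rfl⟩, ?_⟩
  rintro _ ⟨g, hg, c, hc, rfl⟩ a ha
  have hb := additive_le_of_digits hl ha
  have hc : c ≤ l 1 := hc
  refine ⟨_, hS' g hg ((l a + c) % k) (Nat.mod_lt _ hk), (l a + c) / k, ?_, ?_⟩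
  · exact Nat.div_le_of_le_mul (by omega)
  · ext v
    dsimp only
    rw [additive_smul_add hl, add_assoc, mul_add, add_assoc, Nat.div_add_mod]

theorem Recognizable.lt {l m : (ι → ℕ) → ℕ} (hk : 0 < k) (hl : ∀ v w, l (v + w) = l v + l w)
    (hm : ∀ v w, m (v + w) = m v + m w) : Recognizable k fun v => l v < m v := by
  refine ⟨(fun (e : ℤ) v => 0 < (m v : ℤ) - l v + e) '' Set.Icc (-(l 1 : ℤ)) (m 1),
    (Set.finite_Icc _ _).image _, ⟨0, by simp, by ext v; simp⟩, ?_⟩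
  rintro _ ⟨e, ⟨he, he'⟩, rfl⟩ a ha
  have hk' : (0 : ℤ) < k := by exact_mod_cast hk
  have h₁ : (l a : ℤ) + l 1 ≤ k * l 1 := by exact_mod_cast additive_le_of_digits hl ha
  have h₂ : (m a : ℤ) + m 1 ≤ k * m 1 := by exact_mod_cast additive_le_of_digits hm ha
  set b : ℤ := m a - l a + e with hb
  have hd : b - 1 = k * ((b - 1) / k) + (b - 1) % k := (Int.mul_ediv_add_emod _ _).symm
  have hr := Int.emod_nonneg (b - 1) hk'.ne'
  have hr' := Int.emod_lt_of_pos (b - 1) hk'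
  -- The new offset is the ceiling of b / k: for an integer X, k X + b > 0 iff X + ⌈b / k⌉ > 0.
  refine ⟨(b - 1) / k + 1, ⟨?_, ?_⟩, ?_⟩
  · have : -(l 1 : ℤ) - 1 ≤ (b - 1) / k := by
      rw [Int.le_ediv_iff_mul_le hk']
      linarith
    linarith
  · have : (b - 1) / k < m 1 := by
      rw [Int.ediv_lt_iff_lt_mul hk']
      linarith
    linarith
  · ext v
    dsimp only
    rw [additive_smul_add hl, additive_smul_add hm]
    push_cast
    set q := (b - 1) / (k : ℤ)
    set X : ℤ := m v - l v with hX
    have hE : (k * m v + m a : ℤ) - (k * l v + l a) + e = k * (X + q) + (b - 1) % k + 1 := by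
      rw [hX]
      linarith
    rw [hE]
    constructor
    · intro h
      have : 0 ≤ X + q := by linarith
      have := mul_nonneg hk'.le this
      linarith
    · intro h
      by_contra! h'
      have : (k : ℤ) * (X + q) ≤ k * (-1) := mul_le_mul_of_nonneg_left (by linarith) hk'.le
      linarith

theorem Recognizable.eq {l m : (ι → ℕ) → ℕ} (hk : 0 < k) (hl : ∀ v w, l (v + w) = l v + l w)
    (hm : ∀ v w, m (v + w) = m v + m w) : Recognizable k fun v => l v = m v := by
  have := (Recognizable.lt hk hl hm).not.and (Recognizable.lt hk hm hl).not
  convert this using 2 with v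
  simp only [not_lt]
  omega

end Linear

/-! ### Base-`k` representations -/

theorem baseRep_zero (k : ℕ) (hk : 2 ≤ k) : baseRep k hk 0 = [] := by
  simp [baseRep]

theorem baseRep_mul_add (k : ℕ) (hk : 2 ≤ k) (n : ℕ) (a : Fin k) (h : k * n + a ≠ 0) :
    baseRep k hk (k * n + a) = baseRep k hk n ++ [a] := by
  have hd : Nat.digits k (k * n + a) = (a : ℕ) :: Nat.digits k n := by
    rw [add_comm]
    refine Nat.digits_add k hk a n a.2 ?_
    by_contra! h'
    apply h
    simp [h'.1, h'.2]
  simp [baseRep, hd]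

theorem baseRep_induction {k : ℕ} (hk : 2 ≤ k) {p : ℕ → Prop} (zero : p 0)
    (step : ∀ n (a : Fin k), k * n + a ≠ 0 → p n → p (k * n + a)) (n : ℕ) : p n := by
  induction n using Nat.strong_induction_on with
  | _ n ih =>
    rcases Nat.eq_zero_or_pos n with rfl | hn
    · exact zero
    · have := step (n / k) ⟨n % k, Nat.mod_lt _ (by omega)⟩
      simp only [Nat.div_add_mod] at this
      exact this hn.ne' (ih _ (Nat.div_lt_self hn hk))

/-- An automatic sequence has a finite `k`-kernel. -/
theorem IsAutomatic.exists_finite_kernel {A : Type*} {k : ℕ} {hk : 2 ≤ k} {x : ℕ → A}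
    (hx : IsAutomatic k hk x) : ∃ S : Set (ℕ → A), S.Finite ∧ x ∈ S ∧
      ∀ g ∈ S, ∀ a < k, (fun n => g (k * n + a)) ∈ S := by
  obtain ⟨σ, _, M, hM⟩ := hx
  -- The state `none` is a copy of the initial state that is fixed by leading zeros.
  let step : Option σ → Fin k → Option σ := fun s a =>
    match s with
    | none => if (a : ℕ) = 0 then none else some (M.step M.start a)
    | some s => some (M.step s a)
  let val : Option σ → σ := fun s => s.getD M.start
  let st : ℕ → Option σ := fun n => (baseRep k hk n).foldl step none
  have st_zero : st 0 = none := by simp [st, baseRep_zero]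
  have st_step : ∀ n (a : Fin k), st (k * n + a) = step (st n) a := by
    intro n a
    by_cases h : k * n + a = 0
    · have hn : n = 0 := by
        by_contra hn
        have : 0 < k * n := Nat.mul_pos (by omega) (Nat.pos_of_ne_zero hn)
        omega
      have ha : (a : ℕ) = 0 := by omega
      rw [h, hn, st_zero]
      simp [step, ha]
    · simp only [st]
      rw [baseRep_mul_add k hk n a h, List.foldl_append]
      rfl
  have st_val : ∀ n, (st n = none → n = 0) ∧
      val (st n) = (baseRep k hk n).foldl M.step M.start := by
    refine baseRep_induction hk ⟨fun _ => rfl, by simp [st_zero, val, baseRep_zero]⟩ ?_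
    rintro n a h ⟨hn, hv⟩
    rw [st_step, baseRep_mul_add k hk n a h, List.foldl_append, ← hv]
    cases hs : st n with
    | none =>
      have hn := hn hs
      subst hn
      have ha : (a : ℕ) ≠ 0 := by simpa using h
      simp [step, ha, val]
    | some s => simp [step, val]
  -- Appending a last digit to n applies one more transition after `st n`; it is absorbed into h,
  -- and there are finitely many self-maps h of the state set.
  refine ⟨Set.range fun (h : Option σ → Option σ) n => M.output (val (h (st n))),
    Set.finite_range _, ⟨id, ?_⟩, ?_⟩
  · ext n
    rw [← hM n]
    exact congrArg M.output (st_val n).2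
  · rintro _ ⟨h, rfl⟩ a ha
    refine ⟨fun s => h (step s ⟨a, ha⟩), ?_⟩
    ext n
    exact congrArg (fun s => M.output (val (h s))) (st_step n ⟨a, ha⟩).symm

/-! ### Regular sequences -/

/-- A finite family of sequences whose values at `k n + a` are sums of `k` members of the family
at `n` consists of regular sequences. -/
theorem isRegular_of_family {k : ℕ} (hk : 2 ≤ k) {σ : Type*} [Finite σ] (c : σ → ℕ → ℕ)
    (t : σ → Fin k → Fin k → σ) (h : ∀ s n (a : Fin k), c s (k * n + a) = ∑ b, c (t s a b) n)
    (s : σ) : IsRegular k hk (c s) := by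
  classical
  have := Fintype.ofFinite σ
  let e := Fintype.equivFin σ
  -- The row vector holds the values of the whole family at 0; multiplying by the digit matrices on
  -- the right carries it to the values at n.
  let u : Fin (Fintype.card σ) → ℕ := fun i => c (e.symm i) 0
  let μ : Fin k → Matrix (Fin (Fintype.card σ)) (Fin (Fintype.card σ)) ℕ := fun a =>
    Matrix.of fun i j => ∑ b, if e (t (e.symm j) a b) = i then 1 else 0
  have key : ∀ n, Matrix.vecMul u ((baseRep k hk n).map μ).prod = fun i => c (e.symm i) n := by
    refine baseRep_induction hk (by simp [baseRep_zero, u]) ?_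
    intro n a hna ih
    rw [baseRep_mul_add k hk n a hna, List.map_append, List.prod_append, ← Matrix.vecMul_vecMul, ih]
    ext j
    rw [h]
    simp only [List.map_cons, List.map_nil, List.prod_cons, List.prod_nil, mul_one,
      Matrix.vecMul, dotProduct, μ, Matrix.of_apply, Finset.mul_sum]
    rw [Finset.sum_comm]
    simp
  refine ⟨Fintype.card σ, u, Pi.single (e s) 1, μ, fun n => ?_⟩
  rw [Matrix.dotProduct_mulVec, key]
  simp

theorem ncard_setOf_eq_sum {k : ℕ} (hk : 0 < k) {p : ℕ → Prop} (hp : {y | p y}.Finite) :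
    {y | p y}.ncard = ∑ b : Fin k, {y | p (k * y + b)}.ncard := by
  have : NeZero k := ⟨hk.ne'⟩
  have hinj : ∀ b : ℕ, Function.Injective fun y => k * y + b := fun b y z hyz => by
    simpa [hk.ne'] using hyz
  have hfin : ∀ b : Fin k, Finite {y | p (k * y + b)} := fun b =>
    (hp.preimage (hinj b).injOn).to_subtype
  simp only [← Nat.card_coe_set_eq]
  rw [← Nat.card_sigma]
  refine Nat.card_congr (Equiv.symm ?_)
  refine Equiv.ofBijective (fun z => ⟨k * z.2.1 + z.1, z.2.2⟩) ⟨?_, ?_⟩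
  · rintro ⟨b, y, hy⟩ ⟨b', y', hy'⟩ hz
    have hz : k * y + b = k * y' + b' := congrArg Subtype.val hz
    have hb : b = b' := by
      have := congrArg (· % k) hz
      simp only [Nat.mul_add_mod, Nat.mod_eq_of_lt b.2, Nat.mod_eq_of_lt b'.2] at this
      exact Fin.ext this
    subst hb
    obtain rfl : y = y' := hinj b hz
    rfl
  · rintro ⟨y, hy⟩
    exact ⟨⟨⟨y % k, Nat.mod_lt _ hk⟩, y / k, by simpa [Nat.div_add_mod] using hy⟩,
      Subtype.ext (Nat.div_add_mod y k)⟩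

/-- The number of `y` that a recognizable relation relates to `n` is a regular function
of `n`. -/
theorem Recognizable.isRegular_ncard {ι : Type*} {k : ℕ} (hk : 2 ≤ k) {P : (ι → ℕ) → Prop}
    (hP : Recognizable k P) (e : ℕ → ℕ → ι → ℕ)
    (he : ∀ n a y b, e (k * n + a) (k * y + b) = k • e n y + e a b)
    (he' : ∀ a < k, ∀ b < k, ∀ i, e a b i < k)
    (hfin : ∀ n, {y | P (e n y)}.Finite) : IsRegular k hk fun n => {y | P (e n y)}.ncard := by
  obtain ⟨S, hS, hPS, hS'⟩ := hP
  -- Only kernel members with finite fibres are kept: `ncard` is 0 on infinite sets, where the split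
  -- by last digit could fail.
  let T : Set ((ι → ℕ) → Prop) := {g ∈ S | ∀ n, {y | g (e n y)}.Finite}
  have hT : Finite T := (hS.subset (Set.sep_subset _ _)).to_subtype
  have hk' : 0 < k := by omega
  let t : T → Fin k → Fin k → T := fun g a b => ⟨fun v => g.1 (k • v + e a b),
    hS' _ g.2.1 _ (he' a a.2 b b.2), fun n => by
      simp only [← he]
      refine (g.2.2 (k * n + a)).preimage (f := fun y => k * y + b) ?_
      exact Function.Injective.injOn fun y z hyz => by simpa [hk'.ne'] using hyz⟩
  refine isRegular_of_family hk (fun (g : T) n => {y | g.1 (e n y)}.ncard) t ?_ ⟨P, hPS, hfin⟩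
  intro g n a
  rw [ncard_setOf_eq_sum hk' (g.2.2 _)]
  simp only [he, t]

/-! ### Counting factors -/

section Factors

variable {A : Type*}

@[simp]
theorem length_factorAt (x : ℕ → A) (i n : ℕ) : (factorAt x i n).length = n := by
  simp [factorAt]

@[simp]
theorem getElem_factorAt (x : ℕ → A) (i n q : ℕ) (h : q < (factorAt x i n).length) :
    (factorAt x i n)[q] = x (i + q) := by
  simp [factorAt]

theorem factorAt_eq_iff (x : ℕ → A) (i j n : ℕ) :
    factorAt x i n = factorAt x j n ↔ ∀ q < n, x (i + q) = x (j + q) := by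
  simp [factorAt]

theorem ncard_factors_eq {x : ℕ → A} {n : ℕ} (P : List A → Prop) :
    {w | w ∈ factors x n ∧ P w}.ncard =
      {i | P (factorAt x i n) ∧ ∀ j < i, factorAt x j n ≠ factorAt x i n}.ncard := by
  symm
  refine Set.ncard_congr (fun i _ => factorAt x i n) (fun i hi => ⟨⟨i, rfl⟩, hi.1⟩) ?_ ?_
  · intro i j hi hj hij
    by_contra hne
    rcases lt_or_gt_of_ne hne with h | h
    · exact hj.2 i h hij
    · exact hi.2 j h hij.symm
  · rintro _ ⟨⟨i, rfl⟩, hw⟩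
    classical
    have hex : ∃ j, factorAt x j n = factorAt x i n := ⟨i, rfl⟩
    refine ⟨Nat.find hex, ⟨?_, fun j hj => ?_⟩, Nat.find_spec hex⟩
    · rwa [Nat.find_spec hex]
    · rw [Nat.find_spec hex]
      exact Nat.find_min hex hj

theorem finite_first_occurrences {x : ℕ → A} {n : ℕ} (hn : (factors x n).Finite)
    (P : List A → Prop) :
    {i | P (factorAt x i n) ∧ ∀ j < i, factorAt x j n ≠ factorAt x i n}.Finite := by
  refine Set.Finite.of_finite_image (f := fun i => factorAt x i n)
    (hn.subset ?_) ?_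
  · rintro _ ⟨i, _, rfl⟩
    exact ⟨i, rfl⟩
  · intro i hi j hj hij
    by_contra hne
    rcases lt_or_gt_of_ne hne with h | h
    · exact hj.2 i h hij
    · exact hi.2 j h hij.symm

theorem IsAutomatic.recognizable_rel {k : ℕ} {hk : 2 ≤ k} {x : ℕ → A} (hx : IsAutomatic k hk x)
    (r : A → A → Prop) {ι : Type*} {l m : (ι → ℕ) → ℕ} (hl : ∀ v w, l (v + w) = l v + l w)
    (hm : ∀ v w, m (v + w) = m v + m w) : Recognizable k fun v => r (x (l v)) (x (m v)) := by
  obtain ⟨S, hS, hxS, hS'⟩ := hx.exists_finite_kernel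
  exact (Recognizable.comp_additive (by omega) hS hS' hxS hl).map₂
    (Recognizable.comp_additive (by omega) hS hS' hxS hm) r

theorem IsAutomatic.isRegular_ncard_factors {k : ℕ} {hk : 2 ≤ k} {x : ℕ → A}
    (hx : IsAutomatic k hk x) (P : List A → Prop)
    (hP : Recognizable k fun v : Fin 6 → ℕ => P (factorAt x (v 1) (v 0))) :
    IsRegular k hk fun n => {w | w ∈ factors x n ∧ P w}.ncard := by
  have hk' : 0 < k := by omega
  have h₁ : Recognizable k fun v : Fin 6 → ℕ => factorAt x (v 2) (v 0) = factorAt x (v 1) (v 0) := by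
    have h := (((Recognizable.lt (ι := Fin 6) (l := fun v => v 3) (m := fun v => v 0) hk'
      (fun _ _ => rfl) (fun _ _ => rfl)).imp (hx.recognizable_rel (· = ·)
        (l := fun v => v 2 + v 3) (m := fun v => v 1 + v 3)
        (fun v w => by simp; ring) (fun v w => by simp; ring))).forall_update hk' 3)
    simpa [Function.update, factorAt_eq_iff] using h
  have h₂ := ((Recognizable.lt (ι := Fin 6) (l := fun v => v 2) (m := fun v => v 1) hk'
      (fun _ _ => rfl) (fun _ _ => rfl)).imp h₁.not).forall_update hk' 2
  have h₃ := hP.and h₂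
  simp only [ncard_factors_eq]
  -- Coordinates 0 and 1 are the length and the position; the other four are slots for bound
  -- variables, on which the final relation does not depend, so they are set to 0.
  have := h₃.isRegular_ncard hk (fun n i => ![n, i, 0, 0, 0, 0])
    (fun n a y b => by simp) (fun a ha b hb => by simp [Fin.forall_fin_succ, ha, hb, hk'])
    (fun n => by simpa [Function.update] using finite_first_occurrences (hx.finite_factors n) P)
  simpa [Function.update] using this

end Factors

/-! ### Primitive and Lyndon words through rotations -/

section Words

variable {A : Type*}

/-- Euclid's algorithm on lengths: one word is a prefix of the other, and the remainder still
commutes with it. -/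
theorem exists_replicate_of_append_comm (u v : List A) (h : u ++ v = v ++ u) :
    ∃ (t : List A) (a b : ℕ), u = (List.replicate a t).flatten ∧
      v = (List.replicate b t).flatten := by
  induction hs : u.length + v.length using Nat.strong_induction_on generalizing u v with
  | _ s ih =>
    rcases eq_or_ne u [] with rfl | hu
    · exact ⟨v, 0, 1, by simp, by simp⟩
    rcases eq_or_ne v [] with rfl | hv
    · exact ⟨u, 1, 0, by simp, by simp⟩
    have hu' := List.length_pos_of_ne_nil hu
    have hv' := List.length_pos_of_ne_nil hv
    rcases List.append_eq_append_iff.1 h with ⟨w, rfl, hw⟩ | ⟨w, rfl, hw⟩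
    · obtain ⟨t, a, b, h₁, h₂⟩ := ih (u.length + w.length) (by simp at hs; omega) u w hw rfl
      exact ⟨t, a, a + b, h₁, by rw [List.replicate_add, List.flatten_append, ← h₁, ← h₂]⟩
    · obtain ⟨t, a, b, h₁, h₂⟩ := ih (w.length + v.length) (by simp at hs; omega) w v
        hw.symm rfl
      exact ⟨t, b + a, b, by rw [List.replicate_add, List.flatten_append, ← h₁, ← h₂], h₂⟩

/-- If rotation by d fixes w, its prefix of length d commutes with the remaining suffix, so both are
powers of a common word. -/
theorem isPower_iff_rotate (w : List A) :
    IsPower w ↔ ∃ d, 0 < d ∧ d < w.length ∧ w.rotate d = w := by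
  constructor
  · rintro ⟨hw, u, m, hm, rfl⟩
    obtain ⟨m, rfl⟩ := Nat.exists_eq_add_of_le' hm
    have hu : u ≠ [] := by
      rintro rfl
      simp at hw
    have hu' := List.length_pos_of_ne_nil hu
    refine ⟨u.length, hu', ?_, ?_⟩
    · simp only [List.length_flatten, List.map_replicate, List.sum_replicate, smul_eq_mul]
      nlinarith
    · rw [List.replicate_succ, List.flatten_cons, List.rotate_append_length_eq]
      rw [← List.flatten_concat, ← List.replicate_succ', List.replicate_succ, List.flatten_cons]
  · rintro ⟨d, hd, hd', h⟩
    rw [List.rotate_eq_drop_append_take hd'.le] at h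
    obtain ⟨t, a, b, h₁, h₂⟩ := exists_replicate_of_append_comm (w.take d) (w.drop d)
      (by rw [h, List.take_append_drop])
    have hw : w ≠ [] := by
      rintro rfl
      simp at hd'
    refine ⟨hw, t, a + b, ?_, ?_⟩
    · have ha : a ≠ 0 := by
        rintro rfl
        have := congrArg List.length h₁
        simp [hw] at this
        omega
      have hb : b ≠ 0 := by
        rintro rfl
        have := congrArg List.length h₂
        simp at this
        omega
      omega
    · rw [List.replicate_add, List.flatten_append, ← h₁, ← h₂, List.take_append_drop]

theorem isPrimitive_iff_rotate (w : List A) :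
    IsPrimitive w ↔ 0 < w.length ∧ ∀ d, 0 < d → d < w.length → w.rotate d ≠ w := by
  rw [IsPrimitive, isPower_iff_rotate, List.length_pos_iff]
  push Not
  rfl

theorem forall_isConjugate_iff {w : List A} (hw : 0 < w.length) (p : List A → Prop) :
    (∀ y, IsConjugate w y → p y) ↔ ∀ d < w.length, p (w.rotate d) := by
  constructor
  · intro h d hd
    refine h _ ⟨w.take d, w.drop d, (List.take_append_drop _ _).symm, ?_⟩
    exact List.rotate_eq_drop_append_take hd.le
  · rintro h _ ⟨u, v, rfl, rfl⟩
    -- When v is empty the cut is at the full length, hence the reduction modulo the length.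
    have := h (u.length % (u ++ v).length) (Nat.mod_lt _ hw)
    rwa [List.rotate_mod, List.rotate_append_length_eq] at this

theorem cons_le_cons_iff_lt_or [LinearOrder A] {a b : A} {w y : List A} :
    a :: w ≤ b :: y ↔ a < b ∨ a = b ∧ w ≤ y := by
  rw [← not_lt, List.cons_lt_cons_iff, ← not_lt]
  grind

/-- Only the first disagreement gives a real constraint. With equal lengths no proper prefix can
occur, so letters decide the order and the condition is first-order in positions. -/
theorem le_iff_getElem [LinearOrder A] {w y : List A} (h : w.length = y.length) :
    w ≤ y ↔ ∀ p (hp : p < w.length), (∀ q (hq : q < p), w[q] = y[q]) → w[p] ≤ y[p] := by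
  induction w generalizing y with
  | nil => simp [List.length_eq_zero_iff.1 h.symm]
  | cons a w ih =>
    cases y with
    | nil => simp at h
    | cons b y =>
      have h' : w.length = y.length := by simpa using h
      rw [cons_le_cons_iff_lt_or, ih h']
      constructor
      · rintro (hab | ⟨rfl, hwy⟩) p hp hq
        · cases p with
          | zero => exact hab.le
          | succ p => exact absurd (hq 0 (by omega)) hab.ne
        · cases p with
          | zero => exact le_rfl
          | succ p =>
            exact hwy p (by simpa using hp) fun q hqp => by simpa using hq (q + 1) (by omega)
      · intro H
        rcases (show a ≤ b from H 0 (by simp) (by simp)).lt_or_eq with hab | rfl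
        · exact Or.inl hab
        · refine Or.inr ⟨rfl, fun p hp hq => ?_⟩
          refine H (p + 1) (by simpa using hp) fun q hqp => ?_
          cases q with
          | zero => rfl
          | succ q => exact hq q (by omega)

theorem getElem_rotate_factorAt (x : ℕ → A) (i n d q : ℕ)
    (h : q < ((factorAt x i n).rotate d).length) :
    ((factorAt x i n).rotate d)[q] = x (i + (q + d) % n) := by
  simp [List.getElem_rotate]

theorem rotate_factorAt_eq_iff (x : ℕ → A) (i n d : ℕ) :
    (factorAt x i n).rotate d = factorAt x i n ↔ ∀ q < n, x (i + q) = x (i + (q + d) % n) := by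
  constructor
  · intro h q hq
    have := List.getElem_of_eq h (i := q) (by simpa using hq)
    simpa [getElem_rotate_factorAt] using this.symm
  · intro h
    refine List.ext_getElem (by simp) fun q hq _ => ?_
    simpa [getElem_rotate_factorAt] using (h q (by simpa using hq)).symm

/-- Comparing a letter of a factor with the letter of a rotation at the same place, without
division: in the tuple `(n, i, d, q, _, _)` the factor has length `n` and starts at `i`,
the rotation is by `d` and the place is `q`. -/
theorem IsAutomatic.recognizable_rotate {k : ℕ} {hk : 2 ≤ k} {x : ℕ → A}
    (hx : IsAutomatic k hk x) (r : A → A → Prop) : Recognizable k fun v : Fin 6 → ℕ =>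
      v 2 < v 0 → v 3 < v 0 → r (x (v 1 + v 3)) (x (v 1 + (v 3 + v 2) % v 0)) := by
  have hk' : 0 < k := by omega
  have h₁ := (Recognizable.lt (ι := Fin 6) (l := fun v => v 3 + v 2) (m := fun v => v 0) hk'
    (fun v w => by simp; ring) (fun _ _ => rfl)).imp (hx.recognizable_rel r
      (l := fun v => v 1 + v 3) (m := fun v => v 1 + (v 3 + v 2))
      (fun v w => by simp; ring) (fun v w => by simp; ring))
  -- Slot 5 is the wrapped index y with q + d = y + n. It is the residue because q, d < n; no such y
  -- exists when q + d < n.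
  have h₂ := ((Recognizable.eq (ι := Fin 6) (l := fun v => v 3 + v 2) (m := fun v => v 5 + v 0) hk'
    (fun v w => by simp; ring) (fun v w => by simp; ring)).imp (hx.recognizable_rel r
      (l := fun v => v 1 + v 3) (m := fun v => v 1 + v 5)
      (fun v w => by simp; ring) (fun v w => by simp; ring))).forall_update hk' 5
  have h₃ := (Recognizable.lt (ι := Fin 6) (l := fun v => v 2) (m := fun v => v 0) hk'
    (fun _ _ => rfl) (fun _ _ => rfl)).imp ((Recognizable.lt (ι := Fin 6) (l := fun v => v 3)
      (m := fun v => v 0) hk' (fun _ _ => rfl) (fun _ _ => rfl)).imp (h₁.and h₂))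
  convert h₃ using 1
  ext v
  refine imp_congr_right fun hd => imp_congr_right fun hq => ?_
  simp only [Function.update, Fin.reduceEq, dite_false, dite_true]
  rcases lt_or_ge (v 3 + v 2) (v 0) with h | h
  · rw [Nat.mod_eq_of_lt h]
    refine ⟨fun hr => ⟨fun _ => hr, fun y hy => by omega⟩, fun hr => hr.1 h⟩
  · have hmod : (v 3 + v 2) % v 0 = v 3 + v 2 - v 0 := by
      rw [Nat.mod_eq_sub_mod h, Nat.mod_eq_of_lt (by omega)]
    rw [hmod]
    refine ⟨fun hr => ⟨fun _ => by omega, fun y hy => ?_⟩, fun hr => hr.2 _ (by omega)⟩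
    rwa [hy, Nat.add_sub_cancel] at hr

theorem IsAutomatic.recognizable_isPrimitive {k : ℕ} {hk : 2 ≤ k} {x : ℕ → A}
    (hx : IsAutomatic k hk x) :
    Recognizable k fun v : Fin 6 → ℕ => IsPrimitive (factorAt x (v 1) (v 0)) := by
  have hk' : 0 < k := by omega
  have zero_lt : ∀ j : Fin 6, Recognizable k fun v : Fin 6 → ℕ => 0 < v j := fun j =>
    Recognizable.lt (l := fun _ => 0) hk' (fun _ _ => rfl) (fun _ _ => rfl)
  have h₁ := (hx.recognizable_rotate (· = ·)).forall_update hk' 3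
  have h₂ := ((zero_lt 2).imp ((Recognizable.lt (ι := Fin 6) (l := fun v => v 2)
    (m := fun v => v 0) hk' (fun _ _ => rfl) (fun _ _ => rfl)).imp h₁.not)).forall_update hk' 2
  convert (zero_lt 0).and h₂ using 1
  ext v
  simp only [isPrimitive_iff_rotate, rotate_factorAt_eq_iff, length_factorAt, Function.update,
    Fin.reduceEq, dite_false, dite_true, Ne]
  refine and_congr_right fun _ => forall_congr' fun d => imp_congr_right fun _ =>
    imp_congr_right fun hd => ?_
  simp [hd]

theorem IsAutomatic.recognizable_isLyndon [LinearOrder A] {k : ℕ} {hk : 2 ≤ k} {x : ℕ → A}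
    (hx : IsAutomatic k hk x) :
    Recognizable k fun v : Fin 6 → ℕ => IsLyndon (factorAt x (v 1) (v 0)) := by
  have hk' : 0 < k := by omega
  have lt : ∀ i j : Fin 6, Recognizable k fun v : Fin 6 → ℕ => v i < v j := fun i j =>
    Recognizable.lt hk' (fun _ _ => rfl) (fun _ _ => rfl)
  have h₁ := ((lt 3 4).imp (hx.recognizable_rotate (· = ·))).forall_update hk' 3
  -- Quantifying over slot 3 under the equation with slot 4 substitutes the place p for q in the
  -- letter comparison.
  have h₂ := ((Recognizable.eq (ι := Fin 6) (l := fun v => v 3) (m := fun v => v 4) hk'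
    (fun _ _ => rfl) (fun _ _ => rfl)).imp (hx.recognizable_rotate (· ≤ ·))).forall_update hk' 3
  have h₃ := ((lt 4 0).imp (h₁.imp h₂)).forall_update hk' 4
  have h₄ := ((lt 2 0).imp h₃).forall_update hk' 2
  convert hx.recognizable_isPrimitive.and h₄ using 1
  ext v
  refine and_congr_right fun hprim => ?_
  have hpos : 0 < (factorAt x (v 1) (v 0)).length := List.length_pos_of_ne_nil hprim.1
  simp only [forall_isConjugate_iff hpos, Function.update, Fin.reduceEq, dite_false, dite_true,
    length_factorAt]
  refine forall_congr' fun d => imp_congr_right fun hd => ?_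
  rw [le_iff_getElem (by simp)]
  simp only [length_factorAt, getElem_factorAt, getElem_rotate_factorAt]
  refine forall_congr' fun p => imp_congr_right fun hp => ?_
  refine imp_congr (forall_congr' fun q => imp_congr_right fun hq => ?_) ?_
  · simp [hd, hq.trans hp]
  · simp [hd, hp]

end Words

end AutoSeq

theorem theorem13 {A : Type*} [LinearOrder A] (k : ℕ) (hk : 2 ≤ k) (x : ℕ → A)
    (hx : AutoSeq.IsAutomatic k hk x) :
    AutoSeq.IsRegular k hk (AutoSeq.primitiveComplexity x) ∧
      AutoSeq.IsRegular k hk (AutoSeq.lyndonComplexity x) :=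
  ⟨hx.isRegular_ncard_factors _ hx.recognizable_isPrimitive,
    hx.isRegular_ncard_factors _ hx.recognizable_isLyndon⟩
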